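/- Let $I=[-1,1]$. A \emph{decorated graph} $F$ consists of a simple graph on $[m]=\{1,\dots,m\}$, $m\ge 1$, with edge set $E(F)$, together with a continuous function $F_{j,k}\colon I\to\mathbb{R}$ for each edge $\{j,k\}\in E(F)$. A \emph{measure-valued kernel} is a symmetric measurable map $W$ from $[0,1]^2$ to the space of Borel probability measures on $I$, and $$t_{\mathrm d}(F,W)=\int_{[0,1]^m}\prod_{\{j,k\}\in E(F)}\Big(\int_I F_{j,k}(\zeta)\,W(x_j,x_k)(d\zeta)\Big)\,dx_1\cdots dx_m .$$ A \emph{measure-valued graphon} (MVG) is an equivalence class of measure-valued kernels, two kernels $W,V$ being equivalent if $t_{\mathrm d}(F,W)=t_{\mathrm d}(F,V)$ for every decorated graph $F$. A weighted graph on $[n]$ is identified with its symmetric adjacency matrix $M\in I^{n\times n}$, and $$t_{\mathrm d}(F,M)=\frac1{n^m}\sum_{i_1,\dots,i_m=1}^n\ \prod_{\{j,k\}\in E(F)}F_{j,k}(M_{i_j,i_k}).$$ Let $W$ be an MVG, represented by a measure-valued kernel also denoted $W$. Let $(U_i)_{i\ge1}$ be i.i.d. uniform random variables on $[0,1]$ on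 a probability space $(\Omega,\mathcal F,\mathbb P)$. On the same space, for every $n\in\mathbb N$, let $\mathbb G(n,W)$ be a random weighted graph on $[n]$ (a random symmetric matrix with entries in $I$) whose edge weights $\mathbb G(n,W)(i,j)$, $1\le i<j\le n$, are, given $U_1,\dots,U_n$, conditionally independent with $\mathbb G(n,W)(i,j)$ distributed as $W(U_i,U_j)$; the diagonal entries may be arbitrary random variables with values in $I$, and the joint law of the graphs $\mathbb G(n,W)$ for different $n$ is not restricted further. Then, $\mathbb P$-almost surely, $\mathbb G(n,W)\to W$ as $n\to\infty$. That is, $\mathbb P$-almost surely, for every decorated graph $F$ simultaneously, $$t_{\mathrm d}(F,\mathbb G(n,W))\longrightarrow t_{\mathrm d}(F,W)\qquad\text{as } n\to\infty .$$ -/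

import Mathlib

open MeasureTheory ProbabilityTheory Filter Topology

noncomputable section

namespace MVG

/-- The compact interval `I = [-1, 1]` of edge weights. -/
abbrev I : Type := Set.Icc (-1 : ℝ) 1

/-- A decorated graph `(F, f)`: a simple graph `F` on `m ≥ 1` labelled vertices together with a
map `f` that assigns to each edge of `F` a continuous function on `[-1, 1]`. -/
structure DecoratedGraph where
  m : ℕ
  one_le_m : 1 ≤ m
  skeleton : SimpleGraph (Fin m)
  decoration : skeleton.edgeSet → C(I, ℝ)

/-- A measure-valued kernel: a symmetric measurable map `(x, y) ↦ W (x, y)` from `[0, 1]²` to the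
Borel probability measures on `[-1, 1]`. -/
structure MVKernel where
  toKernel : Kernel (unitInterval × unitInterval) I
  isMarkov : IsMarkovKernel toKernel
  symm : ∀ x y, toKernel (x, y) = toKernel (y, x)

/-- The value of a measure-valued kernel at an unordered pair `{x, y}`. -/
def MVKernel.onPair (W : MVKernel) : Sym2 unitInterval → Measure I :=
  Sym2.lift ⟨fun x y => W.toKernel (x, y), W.symm⟩

open Classical in
/-- The decorated homomorphism density of `F` in a measure-valued kernel `W`:
`∫_{[0,1]^m} ∏_{{j,k} ∈ E(F)} (∫ F_{j,k}(ζ) W(x_j, x_k)(dζ)) dx₁ ⋯ dx_m`. -/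
def MVKernel.homDensity (F : DecoratedGraph) (W : MVKernel) : ℝ :=
  ∫ x : Fin F.m → unitInterval,
    ∏ e : F.skeleton.edgeSet, ∫ ζ, F.decoration e ζ ∂(W.onPair (e.1.map x))

/-- Two measure-valued kernels are equivalent if all their decorated homomorphism densities
agree. -/
instance MVKernel.setoid : Setoid MVKernel where
  r W V := ∀ F : DecoratedGraph, W.homDensity F = V.homDensity F
  iseqv :=
    { refl := fun _ _ => rfl
      symm := fun h F => (h F).symm
      trans := fun h₁ h₂ F => (h₁ F).trans (h₂ F) }

/-- A measure-valued graphon: an equivalence class of measure-valued kernels. -/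
def MVGraphon : Type := Quotient MVKernel.setoid

/-- The measure-valued graphon of a measure-valued kernel. -/
def MVKernel.toMVGraphon (W : MVKernel) : MVGraphon := Quotient.mk MVKernel.setoid W

/-- The decorated homomorphism density of `F` in a measure-valued graphon. -/
def MVGraphon.homDensity (F : DecoratedGraph) (W : MVGraphon) : ℝ :=
  Quotient.lift (fun V : MVKernel => V.homDensity F)
    (fun V₁ V₂ (h : ∀ F : DecoratedGraph, V₁.homDensity F = V₂.homDensity F) => h F) W

/-- Edge-weighted graphs on `n` labelled vertices, identified with their adjacency matrices:
symmetric `n × n` matrices with entries in `[-1, 1]`. -/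
def WeightedGraph (n : ℕ) : Type := {M : Matrix (Fin n) (Fin n) I // M.IsSymm}

/-- The weight `M_{i,j}` at an unordered pair `{i, j}`. -/
def WeightedGraph.onPair {n : ℕ} (M : WeightedGraph n) : Sym2 (Fin n) → I :=
  Sym2.lift ⟨fun i j => M.1 i j, fun i j => M.2.apply j i⟩

open Classical in
/-- The decorated homomorphism density of `F` in a weighted graph:
`n^{-m} ∑_{i₁, …, i_m} ∏_{{j,k} ∈ E(F)} F_{j,k}(M_{i_j, i_k})`. -/
def WeightedGraph.homDensity {n : ℕ} (F : DecoratedGraph) (M : WeightedGraph n) : ℝ :=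
  (1 / (n : ℝ) ^ F.m) * ∑ i : Fin F.m → Fin n,
    ∏ e : F.skeleton.edgeSet, F.decoration e (M.onPair (e.1.map i))

/-- A sequence of weighted graphs on `n = 0, 1, 2, …` vertices converges to the measure-valued
graphon `W` if all decorated homomorphism densities converge. -/
def ConvergesTo (M : (n : ℕ) → WeightedGraph n) (W : MVGraphon) : Prop :=
  ∀ F : DecoratedGraph,
    Tendsto (fun n => (M n).homDensity F) atTop (𝓝 (W.homDensity F))

/-- `U₀, U₁, …` are i.i.d. uniform random variables on `[0, 1]`. -/
structure IsIIDUniform {Ω : Type*} [MeasurableSpace Ω] (P : Measure Ω)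
    (U : ℕ → Ω → unitInterval) : Prop where
  measurable : ∀ i, Measurable (U i)
  indep : iIndepFun U P
  law : ∀ i, P.map (U i) = volume

/-- The σ-algebra generated by the first `n` vertex labels. -/
abbrev labelSigma {Ω : Type*} (U : ℕ → Ω → unitInterval) (n : ℕ) : MeasurableSpace Ω :=
  MeasurableSpace.comap (fun ω (i : Fin n) => U i ω) inferInstance

/-- `X` is a version of the random weighted graph `𝔾(n, W)` with vertex labels
`U₀, …, U_{n-1}`: conditionally on the labels, the edge weights `X_{i,j}`, `i < j`, are
independent and `X_{i,j}` has law `W(U_i, U_j)`. Since nothing is required of the diagonal, both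
graphs without loops (`X_{i,i} = 0`) and sampled diagonals (`X_{i,i}` with law `W(U_i, U_i)`)
are allowed. -/
structure IsSampledGraph {Ω : Type*} [MeasurableSpace Ω] (P : Measure Ω)
    (U : ℕ → Ω → unitInterval) (W : MVKernel) (n : ℕ) (X : Ω → WeightedGraph n) : Prop where
  measurable : ∀ i j, Measurable (fun ω => (X ω).1 i j)
  cond_law : ∀ i j : Fin n, i < j → ∀ A : Set I, MeasurableSet A →
    P⟦{ω | (X ω).1 i j ∈ A} | labelSigma U n⟧
      =ᵐ[P] fun ω => (W.toKernel (U i ω, U j ω)).real A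
  cond_indep : ∀ A : Fin n → Fin n → Set I, (∀ i j, MeasurableSet (A i j)) →
    P⟦{ω | ∀ i j, i < j → (X ω).1 i j ∈ A i j} | labelSigma U n⟧
      =ᵐ[P] fun ω => ∏ p : {p : Fin n × Fin n // p.1 < p.2},
        (P⟦{ω' | (X ω').1 p.1.1 p.1.2 ∈ A p.1.1 p.1.2} | labelSigma U n⟧) ω

end MVG

end

/-!
Fix a decorated graph `F` on `m` vertices. A map of the vertices of `F` into `{0, …, n - 1}` has a
weight in the sampled graph and, given the labels, a conditional mean, which for injective maps is
the product of the integrals of the decorations against the measures `W(U_i, U_j)`. The density of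
the sampled graph is the average of the weights of all `n ^ m` maps. Those that are not injective
contribute only `O(1/n)`, and two averages remain.

* The average deviation of the weights of injective maps from their conditional means. Given the
  labels, the edge weights have a product law (`IsSampledGraph.map_eq_compProd`), so the deviations
  of two maps are uncorrelated unless the two maps have an edge in common, and then two vertices. Only
  a fraction `O(n⁻²)` of all pairs of maps does, so the second moment is `O(n⁻²)`. This is summable,
  and the deviation tends to zero almost surely without any assumption on the joint law of the
  graphs for different `n` (`ae_tendsto_average_deviation`).

* The average of the conditional means, a V-statistic of the labels. Its variance is only `O(1/n)`,
  but all `n` share the one sequence of labels. Hence the averages converge along the squares, and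
  they change little between consecutive squares, because the summands are bounded
  (`tendsto_average_of_tendsto_average_sq`, `IsIIDUniform.ae_tendsto_average`).

To obtain all decorated graphs on one event of full measure, countably many are enough: there are
countably many skeletons, `C(I, ℝ)` is separable, and the densities are Lipschitz in bounded
decorations, uniformly in the graph (`convergesTo_of_denseSeq`).
-/

namespace MVG

/-! ### Counting, products and averages -/

/-- If the maps in `S` are determined by their values off `s`, then `S` contains at most a
fraction `n ^ (-|s|)` of all maps. -/
theorem card_mul_pow_le_of_determined {α : Type*} [Fintype α] [DecidableEq α] {n : ℕ}
    (S : Finset (α → Fin n)) (s : Finset α)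
    (h : ∀ x ∈ S, ∀ y ∈ S, (∀ a ∉ s, x a = y a) → x = y) :
    S.card * n ^ s.card ≤ n ^ Fintype.card α := by
  have h1 : S.card ≤ n ^ Fintype.card {a // a ∉ s} := by
    have := Finset.card_le_card_of_injOn (s := S)
      (t := (Finset.univ : Finset ({a // a ∉ s} → Fin n)))
      (fun x a => x a.1) (fun _ _ => Finset.mem_coe.2 (Finset.mem_univ _))
      (fun x hx y hy hxy => h x hx y hy fun a ha => congrFun hxy ⟨a, ha⟩)
    simpa using this
  have h2 : Fintype.card α = Fintype.card {a // a ∉ s} + s.card := by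
    have := Fintype.card_subtype_compl (fun a => a ∈ s)
    have h3 := Finset.card_le_univ s
    simp only [Fintype.card_coe] at this
    omega
  rw [h2, pow_add]
  exact Nat.mul_le_mul_right _ h1

/-- A union bound for the number of elements satisfying one of finitely many conditions. -/
theorem card_filter_exists_mul_le {β Q : Type*} [Fintype β] [Fintype Q] (R : Q → β → Prop)
    [∀ q, DecidablePred (R q)] [DecidablePred fun x => ∃ q, R q x] {k N : ℕ}
    (h : ∀ q, (Finset.univ.filter (R q)).card * k ≤ N) :
    (Finset.univ.filter fun x => ∃ q, R q x).card * k ≤ Fintype.card Q * N := by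
  classical
  have : (Finset.univ.filter fun x => ∃ q, R q x) =
      Finset.univ.biUnion fun q => Finset.univ.filter (R q) := by
    ext x; simp
  rw [this]
  calc _ ≤ (∑ q, (Finset.univ.filter (R q)).card) * k :=
        Nat.mul_le_mul_right _ Finset.card_biUnion_le
    _ ≤ Fintype.card Q * N := by
        rw [Finset.sum_mul]
        simpa using Finset.sum_le_sum fun q (_ : q ∈ Finset.univ) => h q

theorem card_filter_not_injective_mul_le {α : Type*} [Fintype α] [DecidableEq α] (n : ℕ) :
    (Finset.univ.filter fun x : α → Fin n => ¬ Function.Injective x).card * n ≤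
      Fintype.card (α × α) * n ^ Fintype.card α := by
  classical
  have key := card_filter_exists_mul_le (β := α → Fin n) (Q := α × α) (k := n)
    (N := n ^ Fintype.card α) (fun q x => q.1 ≠ q.2 ∧ x q.1 = x q.2) (fun q => by
      have := card_mul_pow_le_of_determined
        (Finset.univ.filter fun x : α → Fin n => q.1 ≠ q.2 ∧ x q.1 = x q.2) {q.1} (by
          simp only [Finset.mem_filter, Finset.mem_univ, true_and, Finset.mem_singleton]
          rintro x ⟨hq, hx⟩ y ⟨-, hy⟩ hxy
          funext a
          by_cases ha : a = q.1
          · rw [ha, hx, hy]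
            exact hxy _ hq.symm
          · exact hxy a ha)
      simpa using this)
  refine le_trans (Nat.mul_le_mul_right _ (Finset.card_le_card ?_)) key
  intro x
  simp only [Finset.mem_filter, Finset.mem_univ, true_and, Function.Injective, not_forall]
  rintro ⟨a, b, hab, hne⟩
  exact ⟨(a, b), hne, hab⟩

theorem card_filter_not_injective_sumElim_mul_le (m n : ℕ) :
    (Finset.univ.filter fun p : (Fin m → Fin n) × (Fin m → Fin n) =>
      ¬ Function.Injective (Sum.elim p.1 p.2)).card * n ≤ (2 * m) ^ 2 * n ^ (2 * m) := by
  classical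
  have key := card_filter_not_injective_mul_le (α := Fin m ⊕ Fin m) n
  simp only [Fintype.card_prod, Fintype.card_sum, Fintype.card_fin] at key
  rw [show m + m = 2 * m by ring, ← sq] at key
  refine le_trans (Nat.mul_le_mul_right _ ?_) key
  refine Finset.card_le_card_of_injOn (fun p => Sum.elim p.1 p.2) (fun p hp => ?_) ?_
  · simpa using hp
  · intro p _ q _ hpq
    exact Prod.ext (funext fun a => congrFun hpq (.inl a)) (funext fun a => congrFun hpq (.inr a))

/-- Pairs of maps with two coincidences of values (at distinct arguments of the second map) form a
fraction `O(n⁻²)` of all pairs. -/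
theorem card_filter_two_coincidences_mul_le (m n : ℕ) :
    (Finset.univ.filter fun p : (Fin m → Fin n) × (Fin m → Fin n) =>
      ∃ q : (Fin m × Fin m) × (Fin m × Fin m), q.2.1 ≠ q.2.2 ∧
        p.1 q.1.1 = p.2 q.2.1 ∧ p.1 q.1.2 = p.2 q.2.2).card * n ^ 2 ≤
      m ^ 4 * n ^ (2 * m) := by
  classical
  have key := card_filter_exists_mul_le (β := (Fin m → Fin n) × (Fin m → Fin n))
    (Q := (Fin m × Fin m) × (Fin m × Fin m)) (k := n ^ 2) (N := n ^ (2 * m))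
    (fun q p => q.2.1 ≠ q.2.2 ∧ p.1 q.1.1 = p.2 q.2.1 ∧ p.1 q.1.2 = p.2 q.2.2) (fun q => by
      by_cases hq : q.2.1 = q.2.2
      · simp [hq]
      have := card_mul_pow_le_of_determined
        ((Finset.univ.filter fun p : (Fin m → Fin n) × (Fin m → Fin n) =>
          q.2.1 ≠ q.2.2 ∧ p.1 q.1.1 = p.2 q.2.1 ∧ p.1 q.1.2 = p.2 q.2.2).image
            fun p => Sum.elim p.1 p.2) {.inr q.2.1, .inr q.2.2} (by
          simp only [Finset.mem_image, Finset.mem_filter, Finset.mem_univ, true_and,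
            Finset.mem_insert, Finset.mem_singleton, not_or]
          rintro _ ⟨p, ⟨-, hp1, hp2⟩, rfl⟩ _ ⟨p', ⟨-, hp1', hp2'⟩, rfl⟩ hxy
          have hl : p.1 = p'.1 := funext fun a => hxy (.inl a) (by simp)
          funext a
          rcases a with a | a
          · exact congrFun hl a
          · by_cases h1 : a = q.2.1
            · simp only [Sum.elim_inr]
              rw [h1, ← hp1, ← hp1', hl]
            by_cases h2 : a = q.2.2
            · simp only [Sum.elim_inr]
              rw [h2, ← hp2, ← hp2', hl]
            exact hxy (.inr a) (by simp [h1, h2]))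
      rw [Finset.card_image_of_injective, Finset.card_pair (by simpa using hq)] at this
      · simpa [two_mul] using this
      · intro p p' hpq
        exact Prod.ext (funext fun a => congrFun hpq (.inl a))
          (funext fun a => congrFun hpq (.inr a)))
  refine key.trans (le_of_eq ?_)
  simp only [Fintype.card_prod, Fintype.card_fin]
  ring

theorem abs_prod_sub_prod_le {ι : Type*} (s : Finset ι) (a b : ι → ℝ) {K : ℝ} (hK : 1 ≤ K)
    (ha : ∀ i, |a i| ≤ K) (hb : ∀ i, |b i| ≤ K) :
    |∏ i ∈ s, a i - ∏ i ∈ s, b i| ≤ K ^ s.card * ∑ i ∈ s, |a i - b i| := by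
  classical
  induction s using Finset.induction_on with
  | empty => simp
  | insert i s hi ih =>
    rw [Finset.prod_insert hi, Finset.prod_insert hi, Finset.sum_insert hi,
      Finset.card_insert_of_notMem hi]
    have hP : |∏ j ∈ s, b j| ≤ K ^ s.card := by
      rw [Finset.abs_prod]
      exact (Finset.prod_le_prod (fun _ _ => abs_nonneg _) fun j _ => hb j).trans (by simp)
    have hKs : 0 ≤ K ^ s.card := by positivity
    have h1 : K ^ s.card * |a i - b i| ≤ K ^ (s.card + 1) * |a i - b i| :=
      mul_le_mul_of_nonneg_right (pow_le_pow_right₀ hK (Nat.le_succ _)) (abs_nonneg _)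
    calc _ = |a i * (∏ j ∈ s, a j - ∏ j ∈ s, b j) + (∏ j ∈ s, b j) * (a i - b i)| := by
          congr 1; ring
      _ ≤ |a i| * |∏ j ∈ s, a j - ∏ j ∈ s, b j| + |∏ j ∈ s, b j| * |a i - b i| := by
          rw [← abs_mul, ← abs_mul]; exact abs_add_le _ _
      _ ≤ K * (K ^ s.card * ∑ j ∈ s, |a j - b j|) + K ^ s.card * |a i - b i| := by
          gcongr
          exact ha i
      _ ≤ K ^ (s.card + 1) * (|a i - b i| + ∑ j ∈ s, |a j - b j|) := by
          rw [mul_add, pow_succ]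
          rw [pow_succ] at h1
          linarith [mul_comm K (K ^ s.card * ∑ j ∈ s, |a j - b j|),
            mul_assoc (K ^ s.card) K (∑ j ∈ s, |a j - b j|),
            mul_left_comm K (K ^ s.card) (∑ j ∈ s, |a j - b j|)]

theorem sum_fin_eq_sum_piFinset_range {m : ℕ} (ψ : (Fin m → ℕ) → ℝ) (n : ℕ) :
    ∑ i : Fin m → Fin n, ψ (fun a => i a) =
      ∑ j ∈ Fintype.piFinset fun _ : Fin m => Finset.range n, ψ j := by
  refine Finset.sum_bij' (fun i _ a => (i a : ℕ))
    (fun j hj a => ⟨j a, Finset.mem_range.1 (Fintype.mem_piFinset.1 hj a)⟩) ?_ ?_ ?_ ?_ ?_ <;>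
    simp

theorem tendsto_sqrt_sq_div_self :
    Tendsto (fun n : ℕ => ((n.sqrt ^ 2 : ℕ) : ℝ) / n) atTop (𝓝 1) := by
  have hs : Tendsto (fun n : ℕ => (n.sqrt : ℝ)) atTop atTop := by
    refine tendsto_natCast_atTop_atTop.comp (tendsto_atTop.2 fun b => ?_)
    filter_upwards [eventually_ge_atTop (b ^ 2)] with n hn
    rw [Nat.le_sqrt, ← sq]
    exact hn
  have h2 : Tendsto (fun n : ℕ => 1 - 2 / (n.sqrt : ℝ)) atTop (𝓝 1) := by
    simpa using (tendsto_const_nhds (x := (1 : ℝ))).sub (hs.const_div_atTop 2)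
  refine tendsto_of_tendsto_of_tendsto_of_le_of_le' h2 tendsto_const_nhds ?_ ?_
  · filter_upwards [eventually_ge_atTop 1] with n hn
    have hn0 : (0 : ℝ) < n := by exact_mod_cast hn
    have hk : (0 : ℝ) < n.sqrt := by exact_mod_cast Nat.sqrt_pos.2 hn
    have h3 : (n : ℝ) ≤ n.sqrt * n.sqrt + n.sqrt + n.sqrt := by exact_mod_cast Nat.sqrt_le_add n
    have h4 : (n.sqrt : ℝ) * n.sqrt ≤ n := by exact_mod_cast Nat.sqrt_le n
    have h5 : (n : ℝ) * 2 / n.sqrt ≥ 2 * n.sqrt := by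
      rw [ge_iff_le, le_div_iff₀ hk]; nlinarith
    rw [le_div_iff₀ hn0]
    push_cast
    have h6 : (1 - 2 / (n.sqrt : ℝ)) * n = n - n * 2 / n.sqrt := by ring
    rw [h6]
    nlinarith
  · filter_upwards [eventually_ge_atTop 1] with n hn
    have hn0 : (0 : ℝ) < n := by exact_mod_cast hn
    rw [div_le_one hn0]
    exact_mod_cast (sq n.sqrt).symm ▸ Nat.sqrt_le n

/-- Averages of a bounded function over the growing cubes `{0, …, n - 1}^m` converge as soon as
they converge along the squares: between `k ^ 2` and `(k + 1) ^ 2` only a vanishing proportion of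
the summands is new. -/
theorem tendsto_average_of_tendsto_average_sq {m : ℕ} (ψ : (Fin m → ℕ) → ℝ) {C t : ℝ}
    (hC : ∀ j, |ψ j| ≤ C)
    (h : Tendsto (fun k : ℕ => 1 / ((k ^ 2 : ℕ) : ℝ) ^ m *
      ∑ i : Fin m → Fin (k ^ 2), ψ (fun a => i a)) atTop (𝓝 t)) :
    Tendsto (fun n : ℕ => 1 / (n : ℝ) ^ m * ∑ i : Fin m → Fin n, ψ (fun a => i a))
      atTop (𝓝 t) := by
  simp only [sum_fin_eq_sum_piFinset_range] at h ⊢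
  set S : ℕ → ℝ := fun n => ∑ j ∈ Fintype.piFinset fun _ : Fin m => Finset.range n, ψ j with hS
  have hsqrt : Tendsto Nat.sqrt atTop atTop := by
    refine tendsto_atTop.2 fun b => ?_
    filter_upwards [eventually_ge_atTop (b ^ 2)] with n hn
    rw [Nat.le_sqrt, ← sq]
    exact hn
  have hinc : ∀ k n : ℕ, k ≤ n → |S n - S k| ≤ C * ((n : ℝ) ^ m - (k : ℝ) ^ m) := by
    intro k n hkn
    have hsub : (Fintype.piFinset fun _ : Fin m => Finset.range k) ⊆
        Fintype.piFinset fun _ : Fin m => Finset.range n :=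
      Fintype.piFinset_subset _ _ fun _ => Finset.range_mono hkn
    have hcard : (((Fintype.piFinset fun _ : Fin m => Finset.range n) \
        Fintype.piFinset fun _ : Fin m => Finset.range k).card : ℝ) = (n : ℝ) ^ m - (k : ℝ) ^ m := by
      rw [Finset.card_sdiff_of_subset hsub, Nat.cast_sub (Finset.card_le_card hsub)]
      simp
    rw [hS]
    simp only
    rw [← Finset.sum_sdiff hsub, add_sub_cancel_right, ← hcard, mul_comm, ← nsmul_eq_mul]
    exact (Finset.abs_sum_le_sum_abs _ _).trans (Finset.sum_le_card_nsmul _ _ _ fun j _ => hC j)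
  -- `r n` is the proportion of the cube of side `n` taken by the cube of side `⌊√n⌋²`.
  set r : ℕ → ℝ := fun n => (((n.sqrt ^ 2 : ℕ) : ℝ) / n) ^ m with hr
  have hr1 : Tendsto r atTop (𝓝 1) := by
    simpa only [one_pow] using tendsto_sqrt_sq_div_self.pow m
  have hA : Tendsto (fun n : ℕ => r n * (1 / ((n.sqrt ^ 2 : ℕ) : ℝ) ^ m * S (n.sqrt ^ 2)))
      atTop (𝓝 t) := by
    simpa using hr1.mul (h.comp hsqrt)
  have hdiff : Tendsto (fun n : ℕ => 1 / (n : ℝ) ^ m * S n -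
      r n * (1 / ((n.sqrt ^ 2 : ℕ) : ℝ) ^ m * S (n.sqrt ^ 2))) atTop (𝓝 0) := by
    have h0 : Tendsto (fun n => C * (1 - r n)) atTop (𝓝 0) := by
      simpa using (tendsto_const_nhds (x := C)).mul ((tendsto_const_nhds (x := (1 : ℝ))).sub hr1)
    refine squeeze_zero_norm' ?_ h0
    filter_upwards [eventually_ge_atTop 1] with n hn
    have hn0 : (0 : ℝ) < (n : ℝ) ^ m := by positivity
    have hk0 : (0 : ℝ) < ((n.sqrt ^ 2 : ℕ) : ℝ) ^ m := by
      have := Nat.sqrt_pos.2 hn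
      positivity
    have e1 : 1 / (n : ℝ) ^ m * S n -
        r n * (1 / ((n.sqrt ^ 2 : ℕ) : ℝ) ^ m * S (n.sqrt ^ 2)) =
        (S n - S (n.sqrt ^ 2)) / (n : ℝ) ^ m := by
      rw [hr]
      simp only [div_pow]
      field_simp
    have e2 : C * (1 - r n) = C * ((n : ℝ) ^ m - ((n.sqrt ^ 2 : ℕ) : ℝ) ^ m) / (n : ℝ) ^ m := by
      rw [hr]
      simp only [div_pow]
      field_simp
    rw [e1, e2, Real.norm_eq_abs, abs_div, abs_of_pos hn0]
    exact div_le_div_of_nonneg_right (hinc _ _ (by rw [sq]; exact Nat.sqrt_le n)) hn0.le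
  simpa using hdiff.add hA

/-! ### Second moments -/

/-- If the products of two members of a family of random variables bounded by `C` have mean zero
for all pairs outside `B`, then the sum of the family has second moment at most `C² |B|`. -/
theorem integral_sum_sq_le {Ω ι : Type*} [MeasurableSpace Ω] (P : Measure Ω)
    [IsProbabilityMeasure P] (Y : ι → Ω → ℝ) (hm : ∀ i, Measurable (Y i)) {C : ℝ}
    (hC : ∀ i ω, |Y i ω| ≤ C) (s : Finset ι) (B : Finset (ι × ι))
    (h : ∀ i ∈ s, ∀ j ∈ s, (i, j) ∉ B → ∫ ω, Y i ω * Y j ω ∂P = 0) :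
    ∫ ω, (∑ i ∈ s, Y i ω) ^ 2 ∂P ≤ C ^ 2 * B.card := by
  classical
  have hb : ∀ i j ω, ‖Y i ω * Y j ω‖ ≤ C ^ 2 := fun i j ω => by
    rw [norm_mul, sq]
    exact mul_le_mul (hC i ω) (hC j ω) (norm_nonneg _) ((abs_nonneg _).trans (hC i ω))
  have hint : ∀ i j, Integrable (fun ω => Y i ω * Y j ω) P := fun i j =>
    Integrable.of_bound ((hm i).mul (hm j)).aestronglyMeasurable (C ^ 2) (ae_of_all _ (hb i j))
  have hle : ∀ p ∈ s ×ˢ s, ∫ ω, Y p.1 ω * Y p.2 ω ∂P ≤ if p ∈ B then C ^ 2 else 0 := by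
    rintro ⟨i, j⟩ hp
    rw [Finset.mem_product] at hp
    split_ifs with hB
    · refine (le_abs_self _).trans ?_
      have := norm_integral_le_of_norm_le_const (μ := P) (ae_of_all _ (hb i j))
      simpa using this
    · exact (h i hp.1 j hp.2 hB).le
  calc ∫ ω, (∑ i ∈ s, Y i ω) ^ 2 ∂P = ∑ p ∈ s ×ˢ s, ∫ ω, Y p.1 ω * Y p.2 ω ∂P := by
        rw [← integral_finsetSum _ fun p _ => hint p.1 p.2]
        congr 1
        funext ω
        rw [sq, Finset.sum_mul_sum, Finset.sum_product]
    _ ≤ ∑ p ∈ s ×ˢ s, if p ∈ B then C ^ 2 else 0 := Finset.sum_le_sum hle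
    _ = ((s ×ˢ s).filter (· ∈ B)).card * C ^ 2 := by
        rw [← Finset.sum_filter, Finset.sum_const, nsmul_eq_mul]
    _ ≤ B.card * C ^ 2 := by
        gcongr
        intro p hp
        exact (Finset.mem_filter.1 hp).2
    _ = C ^ 2 * B.card := mul_comm _ _

/-- Bounded random variables with second moments `O(n⁻²)` tend to zero almost surely. -/
theorem ae_tendsto_zero_of_integral_sq_le {Ω : Type*} [MeasurableSpace Ω] (P : Measure Ω)
    [IsProbabilityMeasure P] (X : ℕ → Ω → ℝ) (hm : ∀ n, Measurable (X n))
    (hb : ∀ n, ∃ C, ∀ ω, |X n ω| ≤ C) {K : ℝ}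
    (hK : ∀ n, 1 ≤ n → ∫ ω, X n ω ^ 2 ∂P ≤ K / (n : ℝ) ^ 2) :
    ∀ᵐ ω ∂P, Tendsto (fun n => X n ω) atTop (𝓝 0) := by
  have hsum : Summable fun n : ℕ => K / ((n + 1 : ℕ) : ℝ) ^ 2 := by
    have := (Real.summable_one_div_nat_pow (p := 2)).2 one_lt_two
    simpa [div_eq_mul_inv] using ((summable_nat_add_iff 1).2 this).mul_left K
  have hK0 : ∀ n : ℕ, 0 ≤ K / ((n + 1 : ℕ) : ℝ) ^ 2 := fun n =>
    (integral_nonneg fun ω => sq_nonneg (X (n + 1) ω)).trans (hK (n + 1) (by omega))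
  have hl : ∀ n, ∫⁻ ω, ENNReal.ofReal (X (n + 1) ω ^ 2) ∂P ≤
      ENNReal.ofReal (K / ((n + 1 : ℕ) : ℝ) ^ 2) := by
    intro n
    obtain ⟨C, hC⟩ := hb (n + 1)
    rw [← ofReal_integral_eq_lintegral_ofReal]
    · exact ENNReal.ofReal_le_ofReal (hK (n + 1) (by omega))
    · refine Integrable.of_bound ((hm _).pow_const 2).aestronglyMeasurable (C ^ 2)
        (ae_of_all _ fun ω => ?_)
      rw [norm_pow]
      exact pow_le_pow_left₀ (norm_nonneg _) (hC ω) 2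
    · exact ae_of_all _ fun ω => sq_nonneg _
  have hfin : ∫⁻ ω, ∑' n, ENNReal.ofReal (X (n + 1) ω ^ 2) ∂P ≠ ⊤ := by
    rw [lintegral_tsum fun n => (((hm _).pow_const 2).ennreal_ofReal).aemeasurable]
    refine ne_top_of_le_ne_top ?_ (ENNReal.tsum_le_tsum hl)
    rw [← ENNReal.ofReal_tsum_of_nonneg hK0 hsum]
    exact ENNReal.ofReal_ne_top
  filter_upwards [ae_lt_top' (AEMeasurable.tsum fun n =>
    (((hm (n + 1)).pow_const 2).ennreal_ofReal).aemeasurable) hfin] with ω hω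
  have h0 := ENNReal.tendsto_atTop_zero_of_tsum_ne_top hω.ne
  have h1 : Tendsto (fun n => X (n + 1) ω ^ 2) atTop (𝓝 0) := by
    have := (ENNReal.tendsto_toReal ENNReal.zero_ne_top).comp h0
    simpa [Function.comp_def, ENNReal.toReal_ofReal (sq_nonneg _)] using this
  rw [← tendsto_add_atTop_iff_nat 1]
  have h2 := h1.sqrt
  simp only [Real.sqrt_sq_eq_abs, Real.sqrt_zero] at h2
  exact (tendsto_zero_iff_abs_tendsto_zero _).2 h2

/-! ### Weights of vertex maps -/

open Classical in
/-- The product `∏_{{j,k} ∈ E(F)} ∫ F_{j,k} dμ(x_j, x_k)` that a vertex map `x` contributes to the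
homomorphism density of `F`, for a family `μ` of measures indexed by the unordered pairs. A weighted
graph enters through the Dirac measures at its edge weights. -/
noncomputable def DecoratedGraph.weight {V : Type*} (F : DecoratedGraph) (μ : Sym2 V → Measure I)
    (x : Fin F.m → V) : ℝ :=
  ∏ e : F.skeleton.edgeSet, ∫ ζ, F.decoration e ζ ∂(μ (e.1.map x))

open Classical in
/-- The product of the sup norms of the decorations, a bound for all weights. -/
noncomputable def DecoratedGraph.bound (F : DecoratedGraph) : ℝ :=
  ∏ e : F.skeleton.edgeSet, ‖F.decoration e‖

theorem MVKernel.homDensity_eq_integral_weight (F : DecoratedGraph) (W : MVKernel) :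
    W.homDensity F = ∫ x : Fin F.m → unitInterval, F.weight W.onPair x := rfl

theorem WeightedGraph.homDensity_eq_sum_weight {n : ℕ} (F : DecoratedGraph) (M : WeightedGraph n) :
    M.homDensity F = (1 / (n : ℝ) ^ F.m) *
      ∑ i : Fin F.m → Fin n, F.weight (fun z => Measure.dirac (M.onPair z)) i := by
  simp [WeightedGraph.homDensity, DecoratedGraph.weight]

instance MVKernel.isProbabilityMeasure_onPair (W : MVKernel) (z : Sym2 unitInterval) :
    IsProbabilityMeasure (W.onPair z) := by
  induction z with
  | _ x y =>
    have := W.isMarkov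
    exact inferInstanceAs (IsProbabilityMeasure (W.toKernel (x, y)))

theorem abs_integral_le_norm (f : C(I, ℝ)) (μ : Measure I) [IsProbabilityMeasure μ] :
    |∫ ζ, f ζ ∂μ| ≤ ‖f‖ := by
  simpa using norm_integral_le_of_norm_le_const (μ := μ) (ae_of_all _ fun ζ => f.norm_coe_le_norm ζ)

theorem DecoratedGraph.abs_weight_le {V : Type*} (F : DecoratedGraph) (μ : Sym2 V → Measure I)
    [∀ z, IsProbabilityMeasure (μ z)] (x : Fin F.m → V) : |F.weight μ x| ≤ F.bound := by
  rw [weight, bound, Finset.abs_prod]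
  exact Finset.prod_le_prod (fun _ _ => abs_nonneg _) fun e _ => abs_integral_le_norm _ _

theorem DecoratedGraph.bound_nonneg (F : DecoratedGraph) : 0 ≤ F.bound :=
  Finset.prod_nonneg fun _ _ => norm_nonneg _

theorem DecoratedGraph.measurable_weight_onPair (F : DecoratedGraph) (W : MVKernel) :
    Measurable fun x : Fin F.m → unitInterval => F.weight W.onPair x := by
  classical
  refine Finset.measurable_prod _ fun e _ => ?_
  obtain ⟨⟨a, b⟩, he⟩ := e
  have h : StronglyMeasurable fun p : unitInterval × unitInterval =>
      ∫ ζ, F.decoration ⟨s(a, b), he⟩ ζ ∂(W.toKernel p) := by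
    have := W.isMarkov
    exact StronglyMeasurable.integral_kernel
      (F.decoration ⟨s(a, b), he⟩).continuous.stronglyMeasurable
  exact h.measurable.comp (g := fun p : unitInterval × unitInterval =>
      ∫ ζ, F.decoration ⟨s(a, b), he⟩ ζ ∂(W.toKernel p))
    (f := fun x : Fin F.m → unitInterval => (x a, x b)) (by fun_prop)

/-! ### Edge weights above the diagonal -/

/-- The ordered pairs `(i, j)` with `i < j`, that is, the edges of the complete graph. -/
abbrev UpperPair (n : ℕ) : Type := {p : Fin n × Fin n // p.1 < p.2}

theorem inf_lt_sup_of_not_isDiag {n : ℕ} {z : Sym2 (Fin n)} (h : ¬ z.IsDiag) : z.inf < z.sup := by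
  induction z with
  | _ a b => simpa [eq_comm] using h

/-- The ordered pair of a non-diagonal unordered pair. -/
def upperPair {n : ℕ} (z : Sym2 (Fin n)) (h : ¬ z.IsDiag) : UpperPair n :=
  ⟨(z.inf, z.sup), inf_lt_sup_of_not_isDiag h⟩

theorem mk_upperPair {n : ℕ} (z : Sym2 (Fin n)) (h : ¬ z.IsDiag) :
    s((upperPair z h).1.1, (upperPair z h).1.2) = z := by
  induction z with
  | _ a b =>
    rcases le_total a b with hab | hab
    · simp [upperPair, hab]
    · simp [upperPair, hab, Sym2.eq_swap]

/-- The weight at an unordered pair of the graph with edge weights `g` and zero diagonal. -/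
def edgeWeight {n : ℕ} (g : UpperPair n → I) (z : Sym2 (Fin n)) : I :=
  if h : z.IsDiag then ⟨0, by norm_num⟩ else g (upperPair z h)

/-- The edge weights of a weighted graph above the diagonal. -/
def WeightedGraph.upper {n : ℕ} (M : WeightedGraph n) : UpperPair n → I :=
  fun p => M.1 p.1.1 p.1.2

theorem WeightedGraph.edgeWeight_upper {n : ℕ} (M : WeightedGraph n) {z : Sym2 (Fin n)}
    (h : ¬ z.IsDiag) : edgeWeight M.upper z = M.onPair z := by
  rw [edgeWeight, dif_neg h]
  conv_rhs => rw [← mk_upperPair z h]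
  rfl

theorem measurable_edgeWeight {n : ℕ} (z : Sym2 (Fin n)) :
    Measurable fun g : UpperPair n → I => edgeWeight g z := by
  unfold edgeWeight
  split_ifs
  · exact measurable_const
  · exact measurable_pi_apply _

theorem DecoratedGraph.measurable_weight_edgeWeight (F : DecoratedGraph) {n : ℕ}
    (i : Fin F.m → Fin n) :
    Measurable fun g : UpperPair n → I => F.weight (fun z => Measure.dirac (edgeWeight g z)) i := by
  classical
  simp only [weight, integral_dirac]
  exact Finset.measurable_prod _ fun e _ =>
    (F.decoration e).continuous.measurable.comp (measurable_edgeWeight _)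

theorem DecoratedGraph.not_isDiag_map (F : DecoratedGraph) {n : ℕ} {i : Fin F.m → Fin n}
    (hi : Function.Injective i) (e : F.skeleton.edgeSet) : ¬ (e.1.map i).IsDiag := by
  rw [Sym2.isDiag_map hi]
  exact F.skeleton.not_isDiag_of_mem_edgeSet e.2

/-- The position above the diagonal to which an injective vertex map sends an edge. -/
def DecoratedGraph.edgePosition (F : DecoratedGraph) {n : ℕ} {i : Fin F.m → Fin n}
    (hi : Function.Injective i) (e : F.skeleton.edgeSet) : UpperPair n :=
  upperPair (e.1.map i) (F.not_isDiag_map hi e)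

theorem DecoratedGraph.mk_edgePosition (F : DecoratedGraph) {n : ℕ} {i : Fin F.m → Fin n}
    (hi : Function.Injective i) (e : F.skeleton.edgeSet) :
    s((F.edgePosition hi e).1.1, (F.edgePosition hi e).1.2) = e.1.map i :=
  mk_upperPair _ _

theorem DecoratedGraph.edgePosition_injective (F : DecoratedGraph) {n : ℕ} {i : Fin F.m → Fin n}
    (hi : Function.Injective i) : Function.Injective (F.edgePosition hi) := fun e e' h =>
  Subtype.ext (Sym2.map.injective hi (by rw [← F.mk_edgePosition hi, h, F.mk_edgePosition hi]))

/-- Two injective vertex maps that send edges to the same position have two values in common. -/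
theorem DecoratedGraph.exists_two_coincidences (F : DecoratedGraph) {n : ℕ}
    {i j : Fin F.m → Fin n} (hi : Function.Injective i) (hj : Function.Injective j)
    {e e' : F.skeleton.edgeSet} (h : F.edgePosition hi e = F.edgePosition hj e') :
    ∃ q : (Fin F.m × Fin F.m) × (Fin F.m × Fin F.m), q.2.1 ≠ q.2.2 ∧
      i q.1.1 = j q.2.1 ∧ i q.1.2 = j q.2.2 := by
  have hz : e.1.map i = e'.1.map j := by
    rw [← F.mk_edgePosition hi, h, F.mk_edgePosition hj]
  obtain ⟨⟨a, b⟩, he⟩ := e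
  obtain ⟨⟨c, d⟩, he'⟩ := e'
  have hcd : c ≠ d := F.skeleton.ne_of_adj he'
  rcases Sym2.eq_iff.1 (show s(i a, i b) = s(j c, j d) from hz) with ⟨h1, h2⟩ | ⟨h1, h2⟩
  · exact ⟨((a, b), (c, d)), hcd, h1, h2⟩
  · exact ⟨((a, b), (d, c)), hcd.symm, h1, h2⟩

/-! ### The law of the edge weights given the labels -/

/-- The conditional law of the edge weights given the labels `u`: the product of the measures
`W(u_i, u_j)` over `i < j`. -/
noncomputable def MVKernel.edgeKernel (W : MVKernel) (n : ℕ) :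
    Kernel (Fin n → unitInterval) (UpperPair n → I) where
  toFun u := Measure.pi fun p : UpperPair n => W.toKernel (u p.1.1, u p.1.2)
  measurable' := by
    have := W.isMarkov
    refine Measurable.measure_of_isPiSystem_of_isProbabilityMeasure generateFrom_pi.symm
      isPiSystem_pi ?_
    rintro _ ⟨A, hA, rfl⟩
    simp only [Measure.pi_pi]
    refine Finset.measurable_prod _ fun p _ => ?_
    exact (W.toKernel.measurable_coe (hA p trivial)).comp
      (f := fun u : Fin n → unitInterval => (u p.1.1, u p.1.2)) (by fun_prop)

theorem MVKernel.edgeKernel_apply (W : MVKernel) (n : ℕ) (u : Fin n → unitInterval) :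
    W.edgeKernel n u = Measure.pi fun p : UpperPair n => W.toKernel (u p.1.1, u p.1.2) := rfl

instance MVKernel.isMarkovKernel_edgeKernel (W : MVKernel) (n : ℕ) :
    IsMarkovKernel (W.edgeKernel n) := by
  have := W.isMarkov
  exact ⟨fun u => by rw [edgeKernel_apply]; infer_instance⟩

theorem WeightedGraph.measurable_upper {Ω : Type*} [MeasurableSpace Ω] {n : ℕ}
    {X : Ω → WeightedGraph n} (h : ∀ i j, Measurable fun ω => (X ω).1 i j) :
    Measurable fun ω => (X ω).upper :=
  measurable_pi_lambda _ fun p => h p.1.1 p.1.2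

/-- The joint law of the labels and the edge weights of a sampled graph. The conditional
probabilities identify it on boxes, which generate the product σ-algebra. -/
theorem IsSampledGraph.map_eq_compProd {Ω : Type*} [MeasurableSpace Ω] {P : Measure Ω}
    [IsProbabilityMeasure P] {U : ℕ → Ω → unitInterval} (hU : ∀ i, Measurable (U i))
    {W : MVKernel} {n : ℕ} {X : Ω → WeightedGraph n} (hX : IsSampledGraph P U W n X) :
    P.map (fun ω => (fun i : Fin n => U i ω, (X ω).upper)) =
      (P.map fun ω (i : Fin n) => U i ω) ⊗ₘ W.edgeKernel n := by
  have := W.isMarkov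
  set L : Ω → Fin n → unitInterval := fun ω i => U i ω with hL
  have hLm : Measurable L := measurable_pi_lambda _ fun i => hU i
  have hXm : Measurable fun ω => (X ω).upper := WeightedGraph.measurable_upper hX.measurable
  have : IsProbabilityMeasure (P.map L) := Measure.isProbabilityMeasure_map hLm.aemeasurable
  have : IsProbabilityMeasure (P.map fun ω => (L ω, (X ω).upper)) :=
    Measure.isProbabilityMeasure_map (hLm.prodMk hXm).aemeasurable
  have hle : labelSigma U n ≤ ‹MeasurableSpace Ω› := hLm.comap_le
  refine ext_of_generate_finite _
    (generateFrom_eq_prod MeasurableSpace.generateFrom_measurableSet generateFrom_pi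
      isCountablySpanning_measurableSet
      (IsCountablySpanning.pi fun _ => isCountablySpanning_measurableSet)).symm
    (MeasurableSpace.isPiSystem_measurableSet.prod isPiSystem_pi) ?_ (by simp)
  rintro _ ⟨B, hB, _, ⟨A, hA, rfl⟩, rfl⟩
  have hB : MeasurableSet B := hB
  have hA' : ∀ p, MeasurableSet (A p) := fun p => hA p trivial
  -- The factors of the box, extended to a family over all pairs as the hypotheses require it.
  set A' : Fin n → Fin n → Set I := fun i j => if h : i < j then A ⟨(i, j), h⟩ else Set.univ with hAA
  have hA'm : ∀ i j, MeasurableSet (A' i j) := fun i j => by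
    rw [hAA]
    dsimp only
    split_ifs
    · exact hA' _
    · exact MeasurableSet.univ
  have hA'p : ∀ p : UpperPair n, A' p.1.1 p.1.2 = A p := fun p => by
    rw [hAA]
    exact dif_pos p.2
  have hset : {ω | ∀ i j, i < j → (X ω).1 i j ∈ A' i j} =
      (fun ω => (X ω).upper) ⁻¹' Set.univ.pi A := by
    ext ω
    simp only [Set.mem_ofPred_eq, Set.mem_preimage, Set.mem_pi, Set.mem_univ, true_imp_iff]
    constructor
    · intro h p
      rw [← hA'p]
      exact h _ _ p.2
    · intro h i j hij
      rw [hA'p ⟨(i, j), hij⟩]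
      exact h ⟨(i, j), hij⟩
  have hpi : MeasurableSet (Set.univ.pi A) := MeasurableSet.univ_pi hA'
  have hcond : P⟦(fun ω => (X ω).upper) ⁻¹' Set.univ.pi A | labelSigma U n⟧ =ᵐ[P]
      fun ω => (W.edgeKernel n (L ω)).real (Set.univ.pi A) := by
    have h1 := hX.cond_indep A' hA'm
    rw [hset] at h1
    have h2 : ∀ᵐ ω ∂P, ∀ p : UpperPair n,
        (P⟦{ω' | (X ω').1 p.1.1 p.1.2 ∈ A' p.1.1 p.1.2} | labelSigma U n⟧) ω =
          (W.toKernel (U p.1.1 ω, U p.1.2 ω)).real (A p) := by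
      rw [ae_all_iff]
      intro p
      have := hX.cond_law p.1.1 p.1.2 p.2 _ (hA'm p.1.1 p.1.2)
      rw [hA'p] at this ⊢
      exact this
    filter_upwards [h1, h2] with ω h1 h2
    rw [h1, Finset.prod_congr rfl fun p _ => h2 p, measureReal_def, W.edgeKernel_apply,
      Measure.pi_pi, ENNReal.toReal_prod]
    rfl
  have hBm : MeasurableSet[labelSigma U n] (L ⁻¹' B) := ⟨B, hB, rfl⟩
  have hreal : P.real (L ⁻¹' B ∩ (fun ω => (X ω).upper) ⁻¹' Set.univ.pi A) =
      ∫ ω in L ⁻¹' B, (W.edgeKernel n (L ω)).real (Set.univ.pi A) ∂P := by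
    have h3 := setIntegral_condExp hle (μ := P)
      (f := ((fun ω => (X ω).upper) ⁻¹' Set.univ.pi A).indicator fun _ => (1 : ℝ))
      ((integrable_const _).indicator (hXm hpi)) hBm
    rw [setIntegral_congr_ae (hLm hB) (hcond.mono fun ω h _ => h)] at h3
    rw [h3, setIntegral_indicator (hXm hpi)]
    simp
  rw [Measure.map_apply (hLm.prodMk hXm) (hB.prod hpi), Measure.compProd_apply_prod hB hpi,
    Set.mk_preimage_prod, setLIntegral_map hB (Kernel.measurable_coe _ hpi) hLm,
    ← ENNReal.ofReal_toReal (measure_ne_top P _), ← measureReal_def, hreal,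
    ofReal_integral_eq_lintegral_ofReal]
  · simp
  · refine Integrable.of_bound (C := 1) ?_ (ae_of_all _ fun ω => ?_)
    · exact ((Kernel.measurable_coe _ hpi).comp hLm).ennreal_toReal.aestronglyMeasurable
    · rw [Real.norm_eq_abs, abs_of_nonneg measureReal_nonneg]
      exact measureReal_le_one
  · exact ae_of_all _ fun ω => measureReal_nonneg

/-! ### Edge randomness given the labels -/

theorem integral_prod_apply_pi {ι E : Type*} [Fintype ι] [Fintype E] (ν : ι → Measure I)
    [∀ p, IsProbabilityMeasure (ν p)] {r : E → ι} (hr : Function.Injective r) (f : E → C(I, ℝ)) :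
    ∫ g, ∏ e, f e (g (r e)) ∂(Measure.pi ν) = ∏ e, ∫ ζ, f e ζ ∂(ν (r e)) := by
  have hind : iIndepFun (fun (e : E) (g : ι → I) => g (r e)) (Measure.pi ν) :=
    (iIndepFun_pi (X := fun _ x => x) fun _ => aemeasurable_id).precomp hr
  rw [hind.integral_fun_prod_comp (f := fun e x => f e x)
    (fun e => (measurable_pi_apply _).aemeasurable)
    (fun e => (f e).continuous.aestronglyMeasurable)]
  refine Finset.prod_congr rfl fun e _ => ?_
  conv_rhs => rw [← (measurePreserving_eval ν (r e)).map_eq]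
  exact (integral_map (measurable_pi_apply (r e)).aemeasurable
    (f e).continuous.aestronglyMeasurable).symm

/-- Products over disjoint sets of independent coordinates are uncorrelated. -/
theorem integral_prod_sub_mul_prod_sub {ι E : Type*} [Fintype ι] [Fintype E] (ν : ι → Measure I)
    [∀ p, IsProbabilityMeasure (ν p)] {r r' : E → ι} (hr : Function.Injective r)
    (hr' : Function.Injective r') (hd : ∀ e e', r e ≠ r' e') (f : E → C(I, ℝ)) :
    ∫ g, (∏ e, f e (g (r e)) - ∏ e, ∫ ζ, f e ζ ∂(ν (r e))) *
      (∏ e, f e (g (r' e)) - ∏ e, ∫ ζ, f e ζ ∂(ν (r' e))) ∂(Measure.pi ν) = 0 := by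
  have h12 := integral_prod_apply_pi ν (r := Sum.elim r r') (hr.sumElim hr' hd) (Sum.elim f f)
  simp only [Fintype.prod_sum_type, Sum.elim_inl, Sum.elim_inr] at h12
  have h1 := integral_prod_apply_pi ν hr f
  have h2 := integral_prod_apply_pi ν hr' f
  set a := ∏ e, ∫ ζ, f e ζ ∂(ν (r e))
  set b := ∏ e, ∫ ζ, f e ζ ∂(ν (r' e))
  have hc : ∀ s : E → ι, Continuous fun g : ι → I => ∏ e, f e (g (s e)) := fun s =>
    continuous_finsetProd _ fun e _ => (f e).continuous.comp (continuous_apply _)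
  have hi : ∀ {h : (ι → I) → ℝ}, Continuous h → Integrable h (Measure.pi ν) := fun hh =>
    hh.integrable_of_hasCompactSupport (HasCompactSupport.of_compactSpace _)
  have hcov : ∀ A B : (ι → I) → ℝ, Continuous A → Continuous B →
      ∫ g, (A g - a) * (B g - b) ∂(Measure.pi ν) = ∫ g, A g * B g ∂(Measure.pi ν) -
        b * ∫ g, A g ∂(Measure.pi ν) - a * ∫ g, B g ∂(Measure.pi ν) + a * b := by
    intro A B hA hB
    have i1 : Integrable (fun g => A g * B g) (Measure.pi ν) := hi (hA.mul hB)
    have i2 : Integrable (fun g => b * A g) (Measure.pi ν) := (hi hA).const_mul b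
    have i3 : Integrable (fun g => a * B g) (Measure.pi ν) := (hi hB).const_mul a
    have i12 : Integrable (fun g => A g * B g - b * A g) (Measure.pi ν) := i1.sub i2
    have i123 : Integrable (fun g => A g * B g - b * A g - a * B g) (Measure.pi ν) := i12.sub i3
    have hexp : ∀ g, (A g - a) * (B g - b) = A g * B g - b * A g - a * B g + a * b :=
      fun g => by ring
    simp only [hexp]
    rw [integral_add i123 (integrable_const _), integral_sub i12 i3, integral_sub i1 i2,
      integral_const_mul, integral_const_mul]
    simp
  rw [hcov _ _ (hc r) (hc r'), h12, h1, h2]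
  ring

/-- The deviation of the weight of a vertex map `i` in the graph with edge weights `g` from its
conditional mean given the labels `u` (for injective `i`). -/
noncomputable def DecoratedGraph.deviation (F : DecoratedGraph) (W : MVKernel) {n : ℕ}
    (i : Fin F.m → Fin n) (u : Fin n → unitInterval) (g : UpperPair n → I) : ℝ :=
  F.weight (fun z => Measure.dirac (edgeWeight g z)) i - F.weight W.onPair (u ∘ i)

theorem DecoratedGraph.abs_deviation_le (F : DecoratedGraph) (W : MVKernel) {n : ℕ}
    (i : Fin F.m → Fin n) (u : Fin n → unitInterval) (g : UpperPair n → I) :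
    |F.deviation W i u g| ≤ 2 * F.bound := by
  have h1 := F.abs_weight_le (fun z => Measure.dirac (edgeWeight g z)) i
  have h2 := F.abs_weight_le W.onPair (u ∘ i)
  exact (abs_sub _ _).trans (by linarith)

theorem DecoratedGraph.measurable_deviation (F : DecoratedGraph) (W : MVKernel) {n : ℕ}
    (i : Fin F.m → Fin n) :
    Measurable fun p : (Fin n → unitInterval) × (UpperPair n → I) =>
      F.deviation W i p.1 p.2 := by
  refine ((F.measurable_weight_edgeWeight i).comp measurable_snd).sub
    ((F.measurable_weight_onPair W).comp (f := fun p : (Fin n → unitInterval) × _ => p.1 ∘ i) ?_)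
  exact measurable_pi_lambda _ fun a => (measurable_pi_apply (i a)).comp measurable_fst

theorem DecoratedGraph.deviation_eq_prod_edgePosition (F : DecoratedGraph) (W : MVKernel) {n : ℕ}
    [Fintype F.skeleton.edgeSet] {i : Fin F.m → Fin n} (hi : Function.Injective i)
    (u : Fin n → unitInterval) (g : UpperPair n → I) :
    F.deviation W i u g =
      ∏ e : F.skeleton.edgeSet, F.decoration e (g (F.edgePosition hi e)) -
      ∏ e : F.skeleton.edgeSet, ∫ ζ, F.decoration e ζ ∂(W.toKernel
        (u (F.edgePosition hi e).1.1, u (F.edgePosition hi e).1.2)) := by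
  simp only [deviation, weight, integral_dirac]
  congr 1
  · refine Finset.prod_congr (Finset.ext fun _ => by simp) fun e _ => ?_
    rw [edgeWeight, dif_neg (F.not_isDiag_map hi e)]
    rfl
  · refine Finset.prod_congr (Finset.ext fun _ => by simp) fun e _ => ?_
    rw [← Sym2.map_map, ← F.mk_edgePosition hi]
    rfl

/-- Given the labels, the deviations of two injective vertex maps are uncorrelated unless the maps
have two values in common. -/
theorem DecoratedGraph.integral_deviation_mul_deviation (F : DecoratedGraph) (W : MVKernel) {n : ℕ}
    (u : Fin n → unitInterval) {i j : Fin F.m → Fin n} (hi : Function.Injective i)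
    (hj : Function.Injective j)
    (hij : ¬ ∃ q : (Fin F.m × Fin F.m) × (Fin F.m × Fin F.m), q.2.1 ≠ q.2.2 ∧
      i q.1.1 = j q.2.1 ∧ i q.1.2 = j q.2.2) :
    ∫ g, F.deviation W i u g * F.deviation W j u g ∂(W.edgeKernel n u) = 0 := by
  classical
  have := W.isMarkov
  have key := integral_prod_sub_mul_prod_sub
    (fun p : UpperPair n => W.toKernel (u p.1.1, u p.1.2)) (F.edgePosition_injective hi)
    (F.edgePosition_injective hj)
    (fun e e' h => hij (F.exists_two_coincidences hi hj h)) F.decoration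
  rw [W.edgeKernel_apply]
  simp only [F.deviation_eq_prod_edgePosition W hi, F.deviation_eq_prod_edgePosition W hj]
  exact key

open Classical in
/-- Given the labels, the sum of the deviations of all injective vertex maps has second moment
`O(n ^ (2m - 2))`, because only the pairs of maps with two values in common contribute. -/
theorem DecoratedGraph.integral_sum_deviation_sq_le (F : DecoratedGraph) (W : MVKernel) (n : ℕ)
    (u : Fin n → unitInterval) :
    (∫ g, (∑ i ∈ Finset.univ.filter fun i : Fin F.m → Fin n => Function.Injective i,
      F.deviation W i u g) ^ 2 ∂(W.edgeKernel n u)) * (n : ℝ) ^ 2 ≤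
      (2 * F.bound) ^ 2 * F.m ^ 4 * (n : ℝ) ^ (2 * F.m) := by
  have := W.isMarkov
  have key := integral_sum_sq_le (W.edgeKernel n u)
    (fun (i : Fin F.m → Fin n) g => F.deviation W i u g)
    (fun i => (F.measurable_deviation W i).comp (f := fun g => (u, g)) (by fun_prop))
    (F.abs_deviation_le W · u)
    (Finset.univ.filter fun i : Fin F.m → Fin n => Function.Injective i)
    (Finset.univ.filter fun p : (Fin F.m → Fin n) × (Fin F.m → Fin n) =>
      ∃ q : (Fin F.m × Fin F.m) × (Fin F.m × Fin F.m), q.2.1 ≠ q.2.2 ∧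
        p.1 q.1.1 = p.2 q.2.1 ∧ p.1 q.1.2 = p.2 q.2.2) (by
      intro i hi j hj hij
      simp only [Finset.mem_filter, Finset.mem_univ, true_and] at hi hj hij
      exact F.integral_deviation_mul_deviation W u hi hj hij)
  have hcard : ((Finset.univ.filter fun p : (Fin F.m → Fin n) × (Fin F.m → Fin n) =>
      ∃ q : (Fin F.m × Fin F.m) × (Fin F.m × Fin F.m), q.2.1 ≠ q.2.2 ∧
        p.1 q.1.1 = p.2 q.2.1 ∧ p.1 q.1.2 = p.2 q.2.2).card : ℝ) * (n : ℝ) ^ 2 ≤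
      (F.m : ℝ) ^ 4 * (n : ℝ) ^ (2 * F.m) := by
    exact_mod_cast card_filter_two_coincidences_mul_le F.m n
  refine (mul_le_mul_of_nonneg_right key (by positivity)).trans ?_
  rw [mul_assoc, mul_assoc]
  exact mul_le_mul_of_nonneg_left hcard (by positivity)

/-! ### Almost sure convergence for one decorated graph -/

section Sampling

variable {Ω : Type*} [MeasurableSpace Ω] {P : Measure Ω} [IsProbabilityMeasure P]
  {U : ℕ → Ω → unitInterval}

open Classical in
/-- The average deviation of a sampled graph from its conditional mean tends to zero: its second
moments are `O(n⁻²)`, whatever the joint law of the graphs for different `n`. -/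
theorem ae_tendsto_average_deviation (hU : ∀ i, Measurable (U i)) (F : DecoratedGraph)
    {W : MVKernel} {G : (n : ℕ) → Ω → WeightedGraph n} (hG : ∀ n, IsSampledGraph P U W n (G n)) :
    ∀ᵐ ω ∂P, Tendsto (fun n : ℕ => 1 / (n : ℝ) ^ F.m *
      ∑ i ∈ Finset.univ.filter fun i : Fin F.m → Fin n => Function.Injective i,
        F.deviation W i (fun a => U a ω) (G n ω).upper) atTop (𝓝 0) := by
  have hb : ∀ (n : ℕ) (p : (Fin n → unitInterval) × (UpperPair n → I)),
      |∑ i ∈ Finset.univ.filter fun i : Fin F.m → Fin n => Function.Injective i,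
        F.deviation W i p.1 p.2| ≤ (Finset.univ.filter fun i : Fin F.m → Fin n =>
          Function.Injective i).card • (2 * F.bound) := fun n p =>
    (Finset.abs_sum_le_sum_abs _ _).trans
      (Finset.sum_le_card_nsmul _ _ _ fun i _ => F.abs_deviation_le W i p.1 p.2)
  have hDm : ∀ n : ℕ, Measurable fun p : (Fin n → unitInterval) × (UpperPair n → I) =>
      ∑ i ∈ Finset.univ.filter fun i : Fin F.m → Fin n => Function.Injective i,
        F.deviation W i p.1 p.2 := fun n =>
    Finset.measurable_sum _ fun i _ => F.measurable_deviation W i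
  have hpair : ∀ n : ℕ, Measurable fun ω => ((fun a : Fin n => U a ω), (G n ω).upper) := fun n =>
    (measurable_pi_lambda _ fun a : Fin n => hU a).prodMk
      (WeightedGraph.measurable_upper (hG n).measurable)
  refine ae_tendsto_zero_of_integral_sq_le P _
    (fun n => ((hDm n).comp (hpair n)).const_mul _) (fun n =>
      ⟨|1 / (n : ℝ) ^ F.m| * ((Finset.univ.filter fun i : Fin F.m → Fin n =>
          Function.Injective i).card • (2 * F.bound)), fun ω => ?_⟩)
    (K := (2 * F.bound) ^ 2 * F.m ^ 4) (fun n hn => ?_)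
  · rw [abs_mul]
    exact mul_le_mul_of_nonneg_left (hb n ((fun a : Fin n => U a ω), (G n ω).upper))
      (abs_nonneg _)
  · have hn0 : (0 : ℝ) < n := by exact_mod_cast hn
    have hLm : Measurable fun ω (a : Fin n) => U a ω := measurable_pi_lambda _ fun a => hU a
    have : IsProbabilityMeasure (P.map fun ω (a : Fin n) => U a ω) :=
      Measure.isProbabilityMeasure_map hLm.aemeasurable
    have hint : Integrable (fun p : (Fin n → unitInterval) × (UpperPair n → I) =>
        (∑ i ∈ Finset.univ.filter fun i : Fin F.m → Fin n => Function.Injective i,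
          F.deviation W i p.1 p.2) ^ 2)
        ((P.map fun ω (a : Fin n) => U a ω) ⊗ₘ W.edgeKernel n) := by
      refine Integrable.of_bound ((hDm n).pow_const 2).aestronglyMeasurable
        (((Finset.univ.filter fun i : Fin F.m → Fin n => Function.Injective i).card •
          (2 * F.bound)) ^ 2) (ae_of_all _ fun p => ?_)
      rw [norm_pow]
      exact pow_le_pow_left₀ (norm_nonneg _) (hb n p) 2
    have hmom : ∫ ω, (∑ i ∈ Finset.univ.filter fun i : Fin F.m → Fin n => Function.Injective i,
        F.deviation W i (fun a => U a ω) (G n ω).upper) ^ 2 ∂P ≤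
        (2 * F.bound) ^ 2 * F.m ^ 4 * (n : ℝ) ^ (2 * F.m) / (n : ℝ) ^ 2 := by
      rw [← integral_map (hpair n).aemeasurable
        (f := fun p : (Fin n → unitInterval) × (UpperPair n → I) =>
          (∑ i ∈ Finset.univ.filter fun i : Fin F.m → Fin n => Function.Injective i,
            F.deviation W i p.1 p.2) ^ 2) ((hDm n).pow_const 2).aestronglyMeasurable,
        (hG n).map_eq_compProd hU, Measure.integral_compProd hint]
      refine (integral_mono_of_nonneg (ae_of_all _ fun u => integral_nonneg fun g => sq_nonneg _)
        (integrable_const _) (ae_of_all _ fun u => (le_div_iff₀ (by positivity)).2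
          (F.integral_sum_deviation_sq_le W n u))).trans ?_
      simp
    simp only [mul_pow]
    rw [integral_const_mul]
    refine (mul_le_mul_of_nonneg_left hmom (by positivity)).trans (le_of_eq ?_)
    field_simp
    ring

/-- The labels at distinct positions are jointly uniform. -/
theorem IsIIDUniform.map_comp_eq_volume (hU : IsIIDUniform P U) {α : Type*} [Fintype α]
    {j : α → ℕ} (hj : Function.Injective j) :
    P.map (fun ω (a : α) => U (j a) ω) = volume := by
  rw [(iIndepFun_iff_map_fun_eq_pi_map fun a => (hU.measurable (j a)).aemeasurable).1
    (hU.indep.precomp hj), volume_pi]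
  simp only [hU.law]

theorem IsIIDUniform.integral_mul_eq_zero (hU : IsIIDUniform P U) {m n : ℕ}
    {φ : (Fin m → unitInterval) → ℝ} (hφ : Measurable φ) (h0 : ∫ x, φ x = 0)
    {i j : Fin m → Fin n} (hij : Function.Injective (Sum.elim i j)) :
    ∫ ω, φ (fun a => U (i a) ω) * φ (fun a => U (j a) ω) ∂P = 0 := by
  have hlaw := hU.map_comp_eq_volume (j := fun a => ((Sum.elim i j a : Fin n) : ℕ))
    (Fin.val_injective.comp hij)
  have hmeas : Measurable fun x : Fin m ⊕ Fin m → unitInterval =>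
      φ (fun a => x (.inl a)) * φ (fun a => x (.inr a)) :=
    (hφ.comp (measurable_pi_lambda _ fun a => measurable_pi_apply (Sum.inl a))).mul
      (hφ.comp (measurable_pi_lambda _ fun a => measurable_pi_apply (Sum.inr a)))
  have h1 := integral_map (μ := P) (φ := fun ω a => U ((Sum.elim i j a : Fin n) : ℕ) ω)
    (measurable_pi_lambda _ fun a => hU.measurable _).aemeasurable
    (f := fun x : Fin m ⊕ Fin m → unitInterval =>
      φ (fun a => x (.inl a)) * φ (fun a => x (.inr a))) hmeas.aestronglyMeasurable
  have h2 := (volume_measurePreserving_sumPiEquivProdPi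
    (fun _ : Fin m ⊕ Fin m => unitInterval)).integral_comp'
      (fun p : (Fin m → unitInterval) × (Fin m → unitInterval) => φ p.1 * φ p.2)
  rw [hlaw] at h1
  refine h1.symm.trans (h2.trans ?_)
  rw [Measure.volume_eq_prod, integral_prod_mul, h0, zero_mul]

/-- The averages of a bounded measurable function over all `m`-tuples of labels converge to its
integral. Their variance is only `O(1/n)`, but this suffices along the squares. -/
theorem IsIIDUniform.ae_tendsto_average (hU : IsIIDUniform P U) {m : ℕ}
    {φ : (Fin m → unitInterval) → ℝ} (hφ : Measurable φ) {C : ℝ} (hC : ∀ x, |φ x| ≤ C) :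
    ∀ᵐ ω ∂P, Tendsto (fun n : ℕ => 1 / (n : ℝ) ^ m *
      ∑ i : Fin m → Fin n, φ (fun a => U (i a) ω)) atTop (𝓝 (∫ x, φ x)) := by
  classical
  set t := ∫ x, φ x with ht
  have hint : Integrable φ := Integrable.of_bound hφ.aestronglyMeasurable C (ae_of_all _ hC)
  have htC : |t| ≤ C := by
    simpa using norm_integral_le_of_norm_le_const (μ := volume) (f := φ) (ae_of_all _ hC)
  set φ₀ : (Fin m → unitInterval) → ℝ := fun x => φ x - t with hφ₀
  have hφ₀m : Measurable φ₀ := hφ.sub_const t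
  have hφ₀0 : ∫ x, φ₀ x = 0 := by
    rw [hφ₀, integral_sub hint (integrable_const _)]
    simp [ht]
  have hφ₀C : ∀ x, |φ₀ x| ≤ 2 * C := fun x => (abs_sub _ _).trans (by linarith [hC x])
  have hUm : ∀ {n : ℕ} (i : Fin m → Fin n), Measurable fun ω (a : Fin m) => U (i a) ω :=
    fun i => measurable_pi_lambda _ fun a => hU.measurable _
  have hmom : ∀ n : ℕ, 1 ≤ n →
      ∫ ω, (1 / (n : ℝ) ^ m * ∑ i : Fin m → Fin n, φ₀ (fun a => U (i a) ω)) ^ 2 ∂P ≤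
        (2 * C) ^ 2 * (2 * m) ^ 2 / n := by
    intro n hn
    have hn0 : (0 : ℝ) < n := by exact_mod_cast hn
    have key := integral_sum_sq_le P (fun (i : Fin m → Fin n) ω => φ₀ (fun a => U (i a) ω))
      (fun i => hφ₀m.comp (hUm i)) (fun i ω => hφ₀C _) Finset.univ
      (Finset.univ.filter fun p : (Fin m → Fin n) × (Fin m → Fin n) =>
        ¬ Function.Injective (Sum.elim p.1 p.2))
      (fun i _ j _ hij => hU.integral_mul_eq_zero hφ₀m hφ₀0 (by simpa using hij))
    have hcard : ((Finset.univ.filter fun p : (Fin m → Fin n) × (Fin m → Fin n) =>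
        ¬ Function.Injective (Sum.elim p.1 p.2)).card : ℝ) * n ≤ (2 * m) ^ 2 * n ^ (2 * m) := by
      exact_mod_cast card_filter_not_injective_sumElim_mul_le m n
    have hcard' := (le_div_iff₀ hn0).2 hcard
    simp only [mul_pow (1 / (n : ℝ) ^ m)]
    rw [integral_const_mul]
    calc _ ≤ (1 / (n : ℝ) ^ m) ^ 2 * ((2 * C) ^ 2 * ((2 * m) ^ 2 * n ^ (2 * m) / n)) := by
          gcongr
          exact key.trans (mul_le_mul_of_nonneg_left hcard' (sq_nonneg _))
      _ = (2 * C) ^ 2 * (2 * m) ^ 2 / n := by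
          field_simp
          ring
  have hsq := ae_tendsto_zero_of_integral_sq_le P
    (fun k ω => 1 / ((k ^ 2 : ℕ) : ℝ) ^ m *
      ∑ i : Fin m → Fin (k ^ 2), φ₀ (fun a => U (i a) ω))
    (fun k => (Finset.measurable_sum _ fun i _ => hφ₀m.comp (hUm i)).const_mul _)
    (fun k => ⟨|1 / ((k ^ 2 : ℕ) : ℝ) ^ m| *
      ((Finset.univ : Finset (Fin m → Fin (k ^ 2))).card • (2 * C)), fun ω => by
        rw [abs_mul]
        exact mul_le_mul_of_nonneg_left ((Finset.abs_sum_le_sum_abs _ _).trans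
          (Finset.sum_le_card_nsmul _ _ _ fun i _ => hφ₀C _)) (abs_nonneg _)⟩)
    (K := (2 * C) ^ 2 * (2 * m) ^ 2) (fun k hk => by
      simpa only [Nat.cast_pow] using hmom (k ^ 2) (Nat.one_le_pow _ _ hk))
  filter_upwards [hsq] with ω hω
  have h1 := tendsto_average_of_tendsto_average_sq (fun j => φ₀ fun a => U (j a) ω)
    (fun j => hφ₀C _) hω
  have h2 : Tendsto (fun n : ℕ => 1 / (n : ℝ) ^ m *
      ∑ i : Fin m → Fin n, φ₀ (fun a => U (i a) ω) + t) atTop (𝓝 t) := by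
    simpa using h1.add_const t
  refine h2.congr' ?_
  filter_upwards [eventually_ge_atTop 1] with n hn
  have hn0 : (n : ℝ) ^ m ≠ 0 := by positivity
  rw [hφ₀]
  simp only [Finset.sum_sub_distrib, Finset.sum_const, Finset.card_univ, Fintype.card_fun,
    Fintype.card_fin, nsmul_eq_mul, Nat.cast_pow]
  field_simp
  ring

/-- The density of a sampled graph is the sum of the average of `F.weight W.onPair` over all tuples
of labels, the average deviation over injective vertex maps, and an error `O(1/n)` that comes from
the other vertex maps, where nothing is known about the diagonal. -/
theorem ae_tendsto_homDensity (hU : IsIIDUniform P U) (F : DecoratedGraph)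
    {W : MVKernel} {G : (n : ℕ) → Ω → WeightedGraph n} (hG : ∀ n, IsSampledGraph P U W n (G n)) :
    ∀ᵐ ω ∂P, Tendsto (fun n => (G n ω).homDensity F) atTop (𝓝 (W.homDensity F)) := by
  classical
  filter_upwards [ae_tendsto_average_deviation hU.measurable F hG,
    hU.ae_tendsto_average (F.measurable_weight_onPair W) (F.abs_weight_le W.onPair)] with ω h1 h2
  rw [← W.homDensity_eq_integral_weight F] at h2
  have h3 := h1.add h2
  rw [zero_add] at h3
  refine (tendsto_iff_of_dist ?_).1 h3
  have h0 : Tendsto (fun n : ℕ => 2 * F.bound * F.m ^ 2 / (n : ℝ)) atTop (𝓝 0) :=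
    tendsto_const_div_atTop_nhds_zero_nat _
  refine squeeze_zero_norm' ?_ h0
  filter_upwards [eventually_ge_atTop 1] with n hn
  have hn0 : (0 : ℝ) < n := by exact_mod_cast hn
  set μ : Sym2 (Fin n) → Measure I := fun z => Measure.dirac ((G n ω).onPair z) with hμ
  set v : Fin n → unitInterval := fun a => U a ω with hv
  have hdev : ∀ i ∈ Finset.univ.filter fun i : Fin F.m → Fin n => Function.Injective i,
      F.deviation W i v (G n ω).upper = F.weight μ i - F.weight W.onPair (v ∘ i) := by
    intro i hi
    have hi : Function.Injective i := (Finset.mem_filter.1 hi).2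
    rw [DecoratedGraph.deviation]
    congr 1
    refine Finset.prod_congr rfl fun e _ => ?_
    simp only [hμ]
    rw [(G n ω).edgeWeight_upper (F.not_isDiag_map hi e)]
  have hsplit : (1 / (n : ℝ) ^ F.m *
      ∑ i ∈ Finset.univ.filter fun i : Fin F.m → Fin n => Function.Injective i,
        F.deviation W i v (G n ω).upper + 1 / (n : ℝ) ^ F.m *
      ∑ i : Fin F.m → Fin n, F.weight W.onPair (fun a => U (i a) ω)) - (G n ω).homDensity F =
      1 / (n : ℝ) ^ F.m *
        ∑ i ∈ Finset.univ.filter fun i : Fin F.m → Fin n => ¬ Function.Injective i,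
          (F.weight W.onPair (v ∘ i) - F.weight μ i) := by
    rw [WeightedGraph.homDensity_eq_sum_weight, Finset.sum_congr rfl hdev,
      ← mul_add, ← mul_sub]
    congr 1
    rw [← Finset.sum_filter_add_sum_filter_not Finset.univ
        (fun i : Fin F.m → Fin n => Function.Injective i) (fun i => F.weight W.onPair _),
      ← Finset.sum_filter_add_sum_filter_not Finset.univ
        (fun i : Fin F.m → Fin n => Function.Injective i) (fun i => F.weight _ i),
      Finset.sum_sub_distrib, Finset.sum_sub_distrib]
    change _ - _ + (∑ i ∈ _, F.weight W.onPair (v ∘ i) + ∑ i ∈ _, F.weight W.onPair (v ∘ i)) -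
      (∑ i ∈ _, F.weight μ i + ∑ i ∈ _, F.weight μ i) = _
    ring
  have hcard : ((Finset.univ.filter fun i : Fin F.m → Fin n =>
      ¬ Function.Injective i).card : ℝ) * n ≤ (F.m : ℝ) ^ 2 * (n : ℝ) ^ F.m := by
    have := card_filter_not_injective_mul_le (α := Fin F.m) n
    simp only [Fintype.card_prod, Fintype.card_fin, ← sq] at this
    exact_mod_cast this
  rw [Real.norm_eq_abs, abs_of_nonneg dist_nonneg, Real.dist_eq, hsplit, abs_mul,
    abs_of_nonneg (by positivity)]
  calc _ ≤ 1 / (n : ℝ) ^ F.m * ((Finset.univ.filter fun i : Fin F.m → Fin n =>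
        ¬ Function.Injective i).card • (2 * F.bound)) := by
        gcongr
        refine (Finset.abs_sum_le_sum_abs _ _).trans
          (Finset.sum_le_card_nsmul _ _ _ fun i _ => (abs_sub _ _).trans ?_)
        linarith [F.abs_weight_le W.onPair (v ∘ i), F.abs_weight_le μ i]
    _ ≤ 1 / (n : ℝ) ^ F.m * (((F.m : ℝ) ^ 2 * (n : ℝ) ^ F.m / n) * (2 * F.bound)) := by
        rw [nsmul_eq_mul]
        have := F.bound_nonneg
        gcongr
        exact (le_div_iff₀ hn0).2 hcard
    _ = 2 * F.bound * F.m ^ 2 / (n : ℝ) := by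
        field_simp

end Sampling

/-! ### All decorated graphs simultaneously -/

open Classical in
/-- Weights depend on the decorations in a Lipschitz way, uniformly in the measures. -/
theorem abs_weight_sub_weight_le {V : Type*} {m : ℕ} (hm : 1 ≤ m) (S : SimpleGraph (Fin m))
    (f g : S.edgeSet → C(I, ℝ)) {K δ : ℝ} (hK : 1 ≤ K) (hf : ∀ e, ‖f e‖ ≤ K)
    (hg : ∀ e, ‖g e‖ ≤ K) (hfg : ∀ e, ‖f e - g e‖ ≤ δ) (μ : Sym2 V → Measure I)
    [∀ z, IsProbabilityMeasure (μ z)] (x : Fin m → V) :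
    |DecoratedGraph.weight ⟨m, hm, S, f⟩ μ x - DecoratedGraph.weight ⟨m, hm, S, g⟩ μ x| ≤
      K ^ Fintype.card S.edgeSet * (Fintype.card S.edgeSet * δ) := by
  have hint : ∀ (h : C(I, ℝ)) (ν : Measure I) [IsProbabilityMeasure ν], Integrable h ν :=
    fun h ν _ => h.continuous.integrable_of_hasCompactSupport (HasCompactSupport.of_compactSpace _)
  refine (abs_prod_sub_prod_le Finset.univ _ _ hK
    (fun e => (abs_integral_le_norm (f e) _).trans (hf e))
    (fun e => (abs_integral_le_norm (g e) _).trans (hg e))).trans ?_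
  rw [Finset.card_univ]
  refine mul_le_mul_of_nonneg_left ?_ (by positivity)
  rw [← nsmul_eq_mul]
  refine Finset.sum_le_card_nsmul _ _ _ fun e _ => ?_
  rw [← integral_sub (hint _ _) (hint _ _)]
  exact (abs_integral_le_norm (f e - g e) _).trans (hfg e)

open Classical in
theorem MVKernel.abs_homDensity_sub_le (W : MVKernel) {m : ℕ} (hm : 1 ≤ m)
    (S : SimpleGraph (Fin m)) (f g : S.edgeSet → C(I, ℝ)) {K δ : ℝ} (hK : 1 ≤ K)
    (hf : ∀ e, ‖f e‖ ≤ K) (hg : ∀ e, ‖g e‖ ≤ K) (hfg : ∀ e, ‖f e - g e‖ ≤ δ) :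
    |W.homDensity ⟨m, hm, S, f⟩ - W.homDensity ⟨m, hm, S, g⟩| ≤
      K ^ Fintype.card S.edgeSet * (Fintype.card S.edgeSet * δ) := by
  have hint : ∀ h, Integrable fun x : Fin m → unitInterval =>
      DecoratedGraph.weight ⟨m, hm, S, h⟩ W.onPair x := fun h =>
    Integrable.of_bound
      (DecoratedGraph.measurable_weight_onPair ⟨m, hm, S, h⟩ W).aestronglyMeasurable
      (DecoratedGraph.bound ⟨m, hm, S, h⟩)
      (ae_of_all _ fun x => DecoratedGraph.abs_weight_le ⟨m, hm, S, h⟩ W.onPair x)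
  have h1 := integral_sub (hint f) (hint g)
  rw [W.homDensity_eq_integral_weight, W.homDensity_eq_integral_weight]
  refine (congrArg abs h1.symm).le.trans ?_
  have h2 := norm_integral_le_of_norm_le_const (μ := (volume : Measure (Fin m → unitInterval)))
    (f := fun x => DecoratedGraph.weight ⟨m, hm, S, f⟩ W.onPair x -
      DecoratedGraph.weight ⟨m, hm, S, g⟩ W.onPair x)
    (ae_of_all _ fun x => abs_weight_sub_weight_le hm S f g hK hf hg hfg W.onPair x)
  simpa using h2

open Classical in
theorem WeightedGraph.abs_homDensity_sub_le {n : ℕ} (M : WeightedGraph n) {m : ℕ} (hm : 1 ≤ m)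
    (S : SimpleGraph (Fin m)) (f g : S.edgeSet → C(I, ℝ)) {K δ : ℝ} (hK : 1 ≤ K) (hδ : 0 ≤ δ)
    (hf : ∀ e, ‖f e‖ ≤ K) (hg : ∀ e, ‖g e‖ ≤ K) (hfg : ∀ e, ‖f e - g e‖ ≤ δ) :
    |M.homDensity ⟨m, hm, S, f⟩ - M.homDensity ⟨m, hm, S, g⟩| ≤
      K ^ Fintype.card S.edgeSet * (Fintype.card S.edgeSet * δ) := by
  set c := K ^ Fintype.card S.edgeSet * (Fintype.card S.edgeSet * δ) with hc
  have hc0 : 0 ≤ c := by positivity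
  rw [M.homDensity_eq_sum_weight, M.homDensity_eq_sum_weight]
  change |1 / (n : ℝ) ^ m * ∑ i : Fin m → Fin n, _ - 1 / (n : ℝ) ^ m * ∑ i : Fin m → Fin n, _| ≤ c
  rw [← mul_sub, ← Finset.sum_sub_distrib, abs_mul, abs_of_nonneg (by positivity)]
  calc _ ≤ 1 / (n : ℝ) ^ m * ((Finset.univ : Finset (Fin m → Fin n)).card • c) := by
        gcongr
        refine (Finset.abs_sum_le_sum_abs _ _).trans (Finset.sum_le_card_nsmul _ _ _ fun i _ => ?_)
        exact abs_weight_sub_weight_le hm S f g hK hf hg hfg _ i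
    _ = (n : ℝ) ^ m / (n : ℝ) ^ m * c := by
        simp only [Finset.card_univ, Fintype.card_fun, Fintype.card_fin, nsmul_eq_mul,
          Nat.cast_pow]
        ring
    _ ≤ c := mul_le_of_le_one_left hc0 (div_self_le_one _)

/-- Convergence of the densities need only be checked for decorations from a dense sequence. -/
theorem convergesTo_of_denseSeq (M : (n : ℕ) → WeightedGraph n) (W : MVKernel)
    (h : ∀ (m : ℕ) (hm : 1 ≤ m) (S : SimpleGraph (Fin m)) (k : S.edgeSet → ℕ),
      Tendsto (fun n => (M n).homDensity
        ⟨m, hm, S, fun e => TopologicalSpace.denseSeq C(I, ℝ) (k e)⟩) atTop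
        (𝓝 (W.homDensity ⟨m, hm, S, fun e => TopologicalSpace.denseSeq C(I, ℝ) (k e)⟩))) :
    ConvergesTo M W.toMVGraphon := by
  classical
  rintro ⟨m, hm, S, f⟩
  change Tendsto _ atTop (𝓝 (W.homDensity ⟨m, hm, S, f⟩))
  rw [Metric.tendsto_atTop]
  intro ε hε
  set K : ℝ := ∑ e, ‖f e‖ + 1 with hKdef
  have hK : 1 ≤ K := by
    have : 0 ≤ ∑ e, ‖f e‖ := Finset.sum_nonneg fun _ _ => norm_nonneg _
    linarith
  have hfK : ∀ e, ‖f e‖ + 1 ≤ K := fun e => by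
    have := Finset.single_le_sum (f := fun e => ‖f e‖) (fun _ _ => norm_nonneg _)
      (Finset.mem_univ e)
    linarith
  set L : ℝ := K ^ Fintype.card S.edgeSet * Fintype.card S.edgeSet with hL
  have hL0 : 0 ≤ L := by positivity
  set δ : ℝ := min 1 (ε / (4 * (L + 1))) with hδ
  have hδ0 : 0 < δ := by positivity
  have hLδ : K ^ Fintype.card S.edgeSet * (Fintype.card S.edgeSet * δ) ≤ ε / 4 := by
    rw [← mul_assoc, ← hL]
    calc L * δ ≤ (L + 1) * (ε / (4 * (L + 1))) := by
          gcongr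
          · linarith
          · exact min_le_right _ _
      _ = ε / 4 := by field_simp
  choose k hk using fun e =>
    (TopologicalSpace.denseRange_denseSeq C(I, ℝ)).exists_dist_lt (f e) hδ0
  have hfg : ∀ e, ‖f e - TopologicalSpace.denseSeq C(I, ℝ) (k e)‖ ≤ δ := fun e => by
    rw [← dist_eq_norm]
    exact (hk e).le
  have hg : ∀ e, ‖TopologicalSpace.denseSeq C(I, ℝ) (k e)‖ ≤ K := fun e => by
    have h1 := norm_sub_norm_le (TopologicalSpace.denseSeq C(I, ℝ) (k e)) (f e)
    rw [norm_sub_rev] at h1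
    linarith [hfg e, hfK e, min_le_left 1 (ε / (4 * (L + 1)))]
  have hf : ∀ e, ‖f e‖ ≤ K := fun e => by linarith [hfK e]
  obtain ⟨N, hN⟩ := Metric.tendsto_atTop.1 (h m hm S k) (ε / 4) (by positivity)
  refine ⟨N, fun n hn => ?_⟩
  have h1 := ((M n).abs_homDensity_sub_le hm S f _ hK hδ0.le hf hg hfg).trans hLδ
  have h2 := (W.abs_homDensity_sub_le hm S f _ hK hf hg hfg).trans hLδ
  have h3 := hN n hn
  rw [← Real.dist_eq] at h1 h2
  rw [dist_comm] at h2
  have h4 := dist_triangle4 ((M n).homDensity ⟨m, hm, S, f⟩)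
    ((M n).homDensity ⟨m, hm, S, fun e => TopologicalSpace.denseSeq C(I, ℝ) (k e)⟩)
    (W.homDensity ⟨m, hm, S, fun e => TopologicalSpace.denseSeq C(I, ℝ) (k e)⟩)
    (W.homDensity ⟨m, hm, S, f⟩)
  linarith

end MVG

theorem mainTheorem10 {Ω : Type*} [MeasurableSpace Ω] (P : Measure Ω) [IsProbabilityMeasure P]
    (U : ℕ → Ω → unitInterval) (hU : MVG.IsIIDUniform P U)
    (𝒲 : MVG.MVGraphon) (W : MVG.MVKernel) (hW : W.toMVGraphon = 𝒲)
    (G : (n : ℕ) → Ω → MVG.WeightedGraph n)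
    (hG : ∀ n, MVG.IsSampledGraph P U W n (G n)) :
    ∀ᵐ ω ∂P, MVG.ConvergesTo (fun n => G n ω) 𝒲 := by
  subst hW
  have h : ∀ᵐ ω ∂P, ∀ (m : ℕ) (hm : 1 ≤ m) (S : SimpleGraph (Fin m)) (k : S.edgeSet → ℕ),
      Tendsto (fun n => (G n ω).homDensity
        ⟨m, hm, S, fun e => TopologicalSpace.denseSeq C(MVG.I, ℝ) (k e)⟩) atTop
        (𝓝 (W.homDensity ⟨m, hm, S, fun e => TopologicalSpace.denseSeq C(MVG.I, ℝ) (k e)⟩)) := by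
    simp only [ae_all_iff]
    exact fun m hm S k => MVG.ae_tendsto_homDensity hU _ hG
  filter_upwards [h] with ω hω
  exact MVG.convergesTo_of_denseSeq _ W hω
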